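/- **Theorem 4.1 (Slepian-type inequality for elliptical vectors).** Write $\mathbf X\sim E_n(\boldsymbol\mu,\boldsymbol\Sigma,\phi)$ if $\mathbf X$ is a random vector in $\mathbb R^n$ with characteristic function $\mathbf t\mapsto e^{i\mathbf t'\boldsymbol\mu}\phi(\mathbf t'\boldsymbol\Sigma\mathbf t)$, where $\boldsymbol\mu\in\mathbb R^n$, $\boldsymbol\Sigma$ is a symmetric positive semidefinite (possibly singular) $n\times n$ matrix, and $\phi$ is such that $\mathbf t\mapsto\phi(\|\mathbf t\|^2)$ is the characteristic function of a probability distribution on $\mathbb R^n$. Let $\mathbf X\sim E_n(\boldsymbol\mu^x,\boldsymbol\Sigma^x,\phi)$ and $\mathbf Y\sim E_n(\boldsymbol\mu^y,\boldsymbol\Sigma^y,\phi)$ with $\boldsymbol\Sigma^x=(\sigma^x_{ij})$, $\boldsymbol\Sigma^y=(\sigma^y_{ij})$. Suppose that $X_i$ and $Y_i$ have the same distribution for each $i$ and that $\sigma^x_{ij}\le\sigma^y_{ij}$ for all $1\le i<j\le n$. Then for every $\mathbf a\in\mathbb R^n$ $$P(X_1\le a_1,\dots,X_n\le a_n)\le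 P(Y_1\le a_1,\dots,Y_n\le a_n),$$ $$P(X_1>a_1,\dots,X_n>a_n)\le P(Y_1>a_1,\dots,Y_n>a_n).$$ Furthermore, both inequalities are strict for every $\mathbf a\in\mathbb R^n$ if $\sigma^x_{ij}<\sigma^y_{ij}$ for some $i,j$, the supports of $\mathbf X$ and $\mathbf Y$ are unbounded, and $\boldsymbol\Sigma^x+\boldsymbol\Sigma^y$ is positive definite (for instance, if at least one of $\boldsymbol\Sigma^x,\boldsymbol\Sigma^y$ is nonsingular). -/

import Mathlib

open MeasureTheory ProbabilityTheory Matrix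

/-- The class `Ψ_n` of characteristic generators: `φ(t₁² + ⋯ + t_n²)` is the characteristic function
of a probability distribution on `ℝⁿ` (in particular `φ 0 = 1`).  Only the values of `φ` on
`[0, ∞)` matter. -/
def IsCharacteristicGenerator (n : ℕ) (φ : ℝ → ℝ) : Prop :=
  ∃ ν : Measure (EuclideanSpace ℝ (Fin n)), IsProbabilityMeasure ν ∧
    ∀ t : EuclideanSpace ℝ (Fin n), charFun ν t = (φ (‖t‖ ^ 2) : ℂ)

/-- `X ∼ E_n(m, S, φ)` under `P`: the random vector `X` has the characteristic function
`t ↦ exp(i t'm) φ(t'St)`, where `φ ∈ Ψ_n` and the dispersion matrix `S` is symmetric and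
positive semidefinite (possibly singular). -/
structure IsElliptical {Ω : Type*} [MeasurableSpace Ω] {n : ℕ}
    (X : Ω → EuclideanSpace ℝ (Fin n)) (P : Measure Ω)
    (m : EuclideanSpace ℝ (Fin n)) (S : Matrix (Fin n) (Fin n) ℝ) (φ : ℝ → ℝ) : Prop where
  aemeasurable : AEMeasurable X P
  generator : IsCharacteristicGenerator n φ
  posSemidef : S.PosSemidef
  charFun_eq : ∀ t : EuclideanSpace ℝ (Fin n),
    charFun (P.map X) t =
      Complex.exp (Complex.I * ((t.ofLp ⬝ᵥ m.ofLp : ℝ) : ℂ)) * (φ (t.ofLp ⬝ᵥ (S *ᵥ t.ofLp)) : ℂ)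

/-! ### Reflections and rotation invariant measures -/

section RotationInvariant

open Filter Topology
open scoped RealInnerProductSpace

variable {E : Type*} [NormedAddCommGroup E] [InnerProductSpace ℝ E] {ι : Type*}

/-! Let `ν` be the spherical law with generator `φ`. If the vectors `v i` have Gram matrix `S`, then
`m + (⟪v i, Z⟫)ᵢ` with `Z ∼ ν` is elliptical with location `m` and dispersion `S`, so orthant
probabilities are `ν`-measures of sets `innerBox v L` with lower sets `L i`. Upper orthants reduce
to lower ones through `Z ↦ -Z`.

Suppose one vector `v k` is replaced by `w` of the same norm whose inner products with the other `v
j` are at least as large. The reflection exchanging `v k` and `w` preserves `ν` and carries the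
points that leave the box into the points that enter it, so the probability does not decrease
(`measure_innerBox_le_update`). If some inner product grows, an open set around the far end of a ray
enters without being matched, and it has positive mass when the support is unbounded
(`measure_innerBox_lt_update`).

In terms of matrices this raises one row and column of a positive definite `S`
(`LinearIndependent.exists_replacement`). The segment between two matrices above a common positive
definite one is cut into steps so small that the rows can be changed one by one without losing
definiteness (`exists_subdivision`). Singular matrices are reached by adding a small multiple of the
identity and passing to a weak limit, which yields only `≤`. Strictness is recovered on the middle
third of the segment, which is uniformly positive definite when the sum of the endpoints is.

Equal marginals give equal locations, and equal diagonals unless `φ = 1` on `[0, ∞)`; in that case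
both vectors are constant. -/

theorem reflection_orthogonal_singleton_apply (d z : E) :
    (Submodule.span ℝ {d})ᗮ.reflection z = z - (2 * ⟪d, z⟫ / ‖d‖ ^ 2) • d := by
  rw [Submodule.reflection_orthogonal_apply, Submodule.reflection_singleton_apply]
  simp only [RCLike.ofReal_real_eq_id, id, neg_sub]
  module

theorem inner_reflection_orthogonal_singleton (d v z : E) :
    ⟪v, (Submodule.span ℝ {d})ᗮ.reflection z⟫ = ⟪v, z⟫ - 2 * ⟪d, z⟫ / ‖d‖ ^ 2 * ⟪v, d⟫ := by
  rw [reflection_orthogonal_singleton_apply, inner_sub_right, inner_smul_right]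

theorem inner_reflection_comm (K : Submodule ℝ E) [K.HasOrthogonalProjection] (v z : E) :
    ⟪v, K.reflection z⟫ = ⟪K.reflection v, z⟫ := by
  rw [← K.reflection.inner_map_map v, Submodule.reflection_reflection]

variable [MeasurableSpace E] [BorelSpace E]

/-- A measure on an inner product space which is invariant under all linear isometries. -/
def IsRotationInvariant (ν : Measure E) : Prop :=
  ∀ g : E ≃ₗᵢ[ℝ] E, ν.map g = ν

/-- The points whose inner products with the vectors `v i` lie in the sets `L i`. -/
def innerBox (v : ι → E) (L : ι → Set ℝ) : Set E :=
  {z | ∀ i, ⟪v i, z⟫ ∈ L i}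

theorem IsRotationInvariant.measure_preimage {ν : Measure E} (hν : IsRotationInvariant ν)
    (g : E ≃ₗᵢ[ℝ] E) (s : Set E) : ν (g ⁻¹' s) = ν s := by
  conv_rhs => rw [← hν g]
  exact (g.toHomeomorph.toMeasurableEquiv.map_apply s).symm

theorem measurableSet_innerBox [Countable ι] (v : ι → E) {L : ι → Set ℝ}
    (hL : ∀ i, MeasurableSet (L i)) : MeasurableSet (innerBox v L) := by
  have : innerBox v L = ⋂ i, (fun z => ⟪v i, z⟫) ⁻¹' (L i) := by
    ext z; simp [innerBox]
  rw [this]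
  exact MeasurableSet.iInter fun i =>
    (by fun_prop : Continuous fun z : E => ⟪v i, z⟫).measurable (hL i)

/-- A rotation invariant measure with unbounded support charges every open set containing the
far end of a ray. -/
theorem IsRotationInvariant.measure_pos_of_ray {ν : Measure E} (hν : IsRotationInvariant ν)
    (hb : ¬ Bornology.IsBounded ν.support) {O : Set E} (hO : IsOpen O) {e : E}
    (he : ∀ᶠ r : ℝ in atTop, r • e ∈ O) (he0 : e ≠ 0) : 0 < ν O := by
  by_contra h
  have h0 : ν O = 0 := by simpa using h
  obtain ⟨r₀, hr₀⟩ := eventually_atTop.1 he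
  apply hb
  refine (Metric.isBounded_closedBall (x := (0 : E)) (r := max r₀ 0 * ‖e‖)).subset fun z hz => ?_
  by_contra hz'
  have hlt : max r₀ 0 * ‖e‖ < ‖z‖ := by simpa using hz'
  have hepos : 0 < ‖e‖ := norm_pos_iff.2 he0
  set r := ‖z‖ / ‖e‖ with hr
  have hmr : max r₀ 0 ≤ r := by
    rw [hr, le_div_iff₀ hepos]; exact hlt.le
  have hnorm : ‖z‖ = ‖r • e‖ := by
    rw [norm_smul, Real.norm_of_nonneg ((le_max_right _ _).trans hmr), hr,
      div_mul_cancel₀ _ hepos.ne']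
  -- A support point far from the origin is moved onto the ray by the reflection exchanging two
  -- vectors of equal norm.
  set g := (Submodule.span ℝ {z - r • e})ᗮ.reflection
  have hg : g z = r • e := Submodule.reflection_sub hnorm
  have hpos := (Measure.mem_support_iff_forall z).1 hz (g ⁻¹' O)
    ((hO.preimage g.continuous).mem_nhds (by
      simpa [hg] using hr₀ r ((le_max_left _ _).trans hmr)))
  rw [hν.measure_preimage, h0] at hpos
  exact lt_irrefl _ hpos

omit [MeasurableSpace E] [BorelSpace E] in
theorem innerBox_mono (v : ι → E) {L L' : ι → Set ℝ} (h : ∀ i, L i ⊆ L' i) :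
    innerBox v L ⊆ innerBox v L' :=
  fun _ hz i => h i (hz i)

section Exchange

variable [DecidableEq ι] {v : ι → E} {L : ι → Set ℝ} {k : ι} {w : E}

omit [MeasurableSpace E] [BorelSpace E] in
/-- The reflection exchanging `v k` and `w` maps the points which leave the box when `v k` is
replaced by `w` to points which enter it. -/
theorem reflection_mapsTo_innerBox_diff (hL : ∀ i, IsLowerSet (L i)) (hw : ‖v k‖ = ‖w‖)
    (hvw : ∀ j, j ≠ k → ⟪v j, v k⟫ ≤ ⟪v j, w⟫) :
    innerBox v L \ innerBox (Function.update v k w) L ⊆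
      (Submodule.span ℝ {v k - w})ᗮ.reflection ⁻¹'
        (innerBox (Function.update v k w) L \ innerBox v L) := by
  rintro z ⟨hz, hz'⟩
  set g := (Submodule.span ℝ {v k - w})ᗮ.reflection
  have hgv : g (v k) = w := Submodule.reflection_sub hw
  have hgw : g w = v k := by rw [← hgv]; exact Submodule.reflection_reflection _ _
  have hwz : ⟪w, z⟫ ∉ L k := by
    intro h
    refine hz' fun i => ?_
    rcases eq_or_ne i k with rfl | hi
    · simpa using h
    · simpa [hi] using hz i
  -- A point that leaves lies on the side of the mirror where reflection adds a nonnegative multiple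
  -- of `v k - w`; this does not increase the products with the other `v i`.
  have hlt : ⟪v k - w, z⟫ < 0 := by
    rw [inner_sub_left, sub_neg]
    by_contra h
    exact hwz (hL k (not_lt.1 h) (hz k))
  refine ⟨fun i => ?_, fun h => hwz ?_⟩
  · rcases eq_or_ne i k with rfl | hi
    · rw [Function.update_self, inner_reflection_comm, hgw]
      exact hz i
    · rw [Function.update_of_ne hi]
      refine hL i ?_ (hz i)
      rw [inner_reflection_orthogonal_singleton]
      have h1 : ⟪v i, v k - w⟫ ≤ 0 := by
        rw [inner_sub_right]; linarith [hvw i hi]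
      have h2 : 2 * ⟪v k - w, z⟫ / ‖v k - w‖ ^ 2 ≤ 0 :=
        div_nonpos_of_nonpos_of_nonneg (by linarith) (by positivity)
      linarith [mul_nonneg_of_nonpos_of_nonpos h2 h1]
  · have := h k
    rwa [inner_reflection_comm, hgv] at this

theorem IsRotationInvariant.measure_innerBox_le_update [Countable ι] {ν : Measure E}
    (hν : IsRotationInvariant ν) (hL : ∀ i, IsLowerSet (L i)) (hw : ‖v k‖ = ‖w‖)
    (hvw : ∀ j, j ≠ k → ⟪v j, v k⟫ ≤ ⟪v j, w⟫) :
    ν (innerBox v L) ≤ ν (innerBox (Function.update v k w) L) := by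
  set A := innerBox v L
  set B := innerBox (Function.update v k w) L
  have hA : MeasurableSet A := measurableSet_innerBox v fun i => (hL i).ordConnected.measurableSet
  have hB : MeasurableSet B := measurableSet_innerBox _ fun i => (hL i).ordConnected.measurableSet
  calc ν A = ν (A ∩ B) + ν (A \ B) := (measure_inter_add_sdiff A hB).symm
    _ ≤ ν (B ∩ A) + ν (B \ A) := by
        rw [Set.inter_comm]
        refine add_le_add_right ?_ _
        exact (measure_mono (reflection_mapsTo_innerBox_diff hL hw hvw)).trans
          (hν.measure_preimage _ (B \ A)).le
    _ = ν B := measure_inter_add_sdiff B hA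

/-- The weak inequality loses whatever part of `B \ A` is not the reflection of `A \ B`. Far along a
ray in a direction close to `v k - w` this part contains an open set. -/
theorem IsRotationInvariant.measure_innerBox_lt_update [Fintype ι] [FiniteDimensional ℝ E]
    {ν : Measure E} [IsFiniteMeasure ν]
    (hν : IsRotationInvariant ν) (hb : ¬ Bornology.IsBounded ν.support)
    (hL : ∀ i, IsLowerSet (L i)) (hL₁ : ∀ i, (L i).Nonempty) (hL₂ : ∀ i, L i ≠ Set.univ)
    {f : E} (hf : ∀ i, ⟪v i, f⟫ < 0) (hw : ‖v k‖ = ‖w‖)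
    (hvw : ∀ j, j ≠ k → ⟪v j, v k⟫ ≤ ⟪v j, w⟫) {l : ι} (hl : l ≠ k) (hlt : ⟪v l, v k⟫ < ⟪v l, w⟫) :
    ν (innerBox v L) < ν (innerBox (Function.update v k w) L) := by
  set A := innerBox v L with hAdef
  set B := innerBox (Function.update v k w) L with hBdef
  have hA : MeasurableSet A := measurableSet_innerBox v fun i => (hL i).ordConnected.measurableSet
  have hB : MeasurableSet B := measurableSet_innerBox _ fun i => (hL i).ordConnected.measurableSet
  choose b hb' using hL₁
  have hc' : ∀ i, ∃ c, c ∉ L i := fun i => by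
    by_contra! h
    exact hL₂ i (Set.eq_univ_of_forall h)
  choose c hc using hc'
  set d := v k - w with hd
  set g := (Submodule.span ℝ {d})ᗮ.reflection with hg
  have hgv : g (v k) = w := Submodule.reflection_sub hw
  have hgw : g w = v k := by rw [← hgv]; exact Submodule.reflection_reflection _ _
  have hd0 : d ≠ 0 := fun h => by
    rw [sub_eq_zero.1 h] at hlt; exact lt_irrefl _ hlt
  have hdd : 0 < ‖d‖ ^ 2 := by positivity
  have hvd : ⟪v k, d⟫ = ‖d‖ ^ 2 / 2 := by
    have : ‖w‖ ^ 2 = ‖v k‖ ^ 2 := by rw [hw]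
    rw [hd, @norm_sub_sq_real, inner_sub_right, real_inner_self_eq_norm_sq, this]; ring
  have hwd : ⟪w, d⟫ = - (‖d‖ ^ 2 / 2) := by
    have : ⟪v k - w, d⟫ = ‖d‖ ^ 2 := real_inner_self_eq_norm_sq d
    rw [inner_sub_left] at this; linarith
  -- the direction of the ray
  obtain ⟨η, hη, hη₁, hη₂, hη₃⟩ : ∃ η : ℝ, 0 < η ∧ 0 < ⟪v k, d + η • f⟫ ∧ ⟪w, d + η • f⟫ < 0 ∧
      0 < ⟪v l, g (d + η • f)⟫ := by
    -- The reflection sends `d` to `-d`, and `⟪v l, d⟫ < 0` by the strict hypothesis. All three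
    -- conditions hold at `η = 0`, hence for small `η > 0`.
    have hvl : 0 < ⟪v l, g (d + (0 : ℝ) • f)⟫ := by
      rw [zero_smul, add_zero, hg, Submodule.reflection_orthogonalComplement_singleton_eq_neg,
        inner_neg_right, hd, inner_sub_right]
      linarith
    have h1 : ∀ᶠ η : ℝ in 𝓝[>] 0, 0 < ⟪v k, d + η • f⟫ :=
      ((by fun_prop : Continuous fun η : ℝ => ⟪v k, d + η • f⟫).tendsto 0).mono_left
        nhdsWithin_le_nhds |>.eventually_const_lt (by simp [hvd]; positivity)
    have h2 : ∀ᶠ η : ℝ in 𝓝[>] 0, ⟪w, d + η • f⟫ < 0 :=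
      ((by fun_prop : Continuous fun η : ℝ => ⟪w, d + η • f⟫).tendsto 0).mono_left
        nhdsWithin_le_nhds |>.eventually_lt_const (by simp [hwd]; positivity)
    have h3 : ∀ᶠ η : ℝ in 𝓝[>] 0, 0 < ⟪v l, g (d + η • f)⟫ :=
      ((by fun_prop : Continuous fun η : ℝ => ⟪v l, g (d + η • f)⟫).tendsto 0).mono_left
        nhdsWithin_le_nhds |>.eventually_const_lt hvl
    obtain ⟨η, h⟩ := (((eventually_mem_nhdsWithin (a := (0 : ℝ)) (s := Set.Ioi 0)).and h1).and
      (h2.and h3)).exists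
    exact ⟨η, h.1.1, h.1.2, h.2.1, h.2.2⟩
  set e := d + η • f with he
  -- Along `d` alone these products are only nonpositive; the term `η • f` makes them strictly
  -- negative.
  have hηj : ∀ j, j ≠ k → ⟪v j, e⟫ < 0 := fun j hj => by
    rw [he, inner_add_right, inner_smul_right, hd, inner_sub_right]
    linarith [hvw j hj, mul_neg_of_pos_of_neg hη (hf j)]
  -- The first three conditions force membership in `B \ A`; the last keeps the mirror image out of
  -- `A`.
  let O : Set E := {z | ∀ j, j ≠ k → ⟪v j, z⟫ < b j} ∩ {z | ⟪w, z⟫ < b k} ∩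
    {z | c k < ⟪v k, z⟫} ∩ {z | c l < ⟪v l, g z⟫}
  have hO : IsOpen O := by
    refine ((IsOpen.inter ?_ ?_).inter ?_).inter ?_
    · simp only [Set.ofPred_forall]
      exact isOpen_iInter_of_finite fun j => isOpen_iInter_of_finite fun _ =>
        isOpen_lt (by fun_prop) continuous_const
    · exact isOpen_lt (by fun_prop) continuous_const
    · exact isOpen_lt continuous_const (by fun_prop)
    · exact isOpen_lt continuous_const (by fun_prop)
  have hup : ∀ {x : ℝ} (y : ℝ), 0 < x → ∀ᶠ r : ℝ in atTop, y < r * x := fun y hx =>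
    (tendsto_id.atTop_mul_const hx).eventually_gt_atTop y
  have hdown : ∀ {x : ℝ} (y : ℝ), x < 0 → ∀ᶠ r : ℝ in atTop, r * x < y := fun y hx =>
    (tendsto_id.atTop_mul_const_of_neg hx).eventually_lt_atBot y
  have hray : ∀ᶠ r : ℝ in atTop, r • e ∈ O := by
    have h1 : ∀ᶠ r : ℝ in atTop, ∀ j, j ≠ k → r * ⟪v j, e⟫ < b j :=
      eventually_all.2 fun j => by
        by_cases hj : j = k
        · simp [hj]
        · filter_upwards [hdown (b j) (hηj j hj)] with r hr _ using hr
    filter_upwards [h1, hdown (b k) hη₂, hup (c k) hη₁, hup (c l) hη₃] with r h1 h2 h3 h4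
    refine ⟨⟨⟨?_, ?_⟩, ?_⟩, ?_⟩ <;> simpa [inner_smul_right]
  have he0 : e ≠ 0 := fun h => by simp [h] at hη₂
  have hOpos : 0 < ν O := hν.measure_pos_of_ray hb hO hray he0
  have hOB : O ⊆ B \ A := by
    rintro z ⟨⟨⟨h1, h2⟩, h3⟩, -⟩
    refine ⟨fun i => ?_, fun h => hc k (hL k (le_of_lt h3) (h k))⟩
    rcases eq_or_ne i k with rfl | hi
    · rw [Function.update_self]; exact hL i (le_of_lt h2) (hb' i)
    · rw [Function.update_of_ne hi]; exact hL i (h1 i hi).le (hb' i)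
  have hdisj : Disjoint (g ⁻¹' (A \ B)) O := by
    rw [Set.disjoint_left]
    rintro z ⟨hz, -⟩ ⟨-, h4⟩
    exact hc l (hL l (le_of_lt h4) (hz l))
  have hsub : g ⁻¹' (A \ B) ⊆ B \ A := fun z hz => by
    have h : g (g z) ∈ B \ A := reflection_mapsTo_innerBox_diff hL hw hvw hz
    rwa [Submodule.reflection_reflection] at h
  have key : ν (A \ B) < ν (B \ A) := by
    calc ν (A \ B) = ν (g ⁻¹' (A \ B)) := (hν.measure_preimage g _).symm
      _ < ν (g ⁻¹' (A \ B)) + ν O := ENNReal.lt_add_right (measure_ne_top _ _) hOpos.ne'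
      _ = ν (g ⁻¹' (A \ B) ∪ O) := (measure_union hdisj hO.measurableSet).symm
      _ ≤ ν (B \ A) := measure_mono (Set.union_subset hsub hOB)
  calc ν A = ν (A ∩ B) + ν (A \ B) := (measure_inter_add_sdiff A hB).symm
    _ < ν (A ∩ B) + ν (B \ A) := ENNReal.add_lt_add_left (measure_ne_top _ _) key
    _ = ν B := by rw [Set.inter_comm, measure_inter_add_sdiff B hA]

end Exchange

end RotationInvariant

/-! ### Realising matrices as Gram matrices -/

section Gram

open scoped RealInnerProductSpace

variable {n : ℕ}

open scoped MatrixOrder in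
theorem Matrix.PosSemidef.exists_gram_eq {S : Matrix (Fin n) (Fin n) ℝ} (hS : S.PosSemidef) :
    ∃ v : Fin n → EuclideanSpace ℝ (Fin n), gram ℝ v = S := by
  obtain ⟨B, hB⟩ := CStarAlgebra.nonneg_iff_eq_star_mul_self.mp hS.nonneg
  refine ⟨fun i => WithLp.toLp 2 fun k => B k i, ?_⟩
  rw [hB]
  ext i j
  simp [Matrix.mul_apply, PiLp.inner_apply, mul_comm]

theorem LinearIndependent.exists_inner_eq {v : Fin n → EuclideanSpace ℝ (Fin n)}
    (hv : LinearIndependent ℝ v) (c : Fin n → ℝ) :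
    ∃ x : EuclideanSpace ℝ (Fin n), ∀ i, ⟪v i, x⟫ = c i := by
  rcases n.eq_zero_or_pos with rfl | hn
  · exact ⟨0, fun i => i.elim0⟩
  have : Nonempty (Fin n) := ⟨⟨0, hn⟩⟩
  let b := basisOfLinearIndependentOfCardEqFinrank hv (by simp)
  refine ⟨(InnerProductSpace.toDual ℝ _).symm (b.constr ℝ c).toContinuousLinearMap, fun i => ?_⟩
  rw [real_inner_comm, InnerProductSpace.toDual_symm_apply]
  have : v i = b i := by simp [b]
  rw [this, LinearMap.coe_toContinuousLinearMap', b.constr_basis]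

/-- One vector of a linearly independent family can be replaced so as to change one row and
column of the Gram matrix, as long as the result is positive semidefinite. -/
theorem LinearIndependent.exists_replacement {v : Fin n → EuclideanSpace ℝ (Fin n)}
    (hv : LinearIndependent ℝ v) {T : Matrix (Fin n) (Fin n) ℝ} (hT : T.PosSemidef) (k : Fin n)
    (hTv : ∀ i j, i ≠ k → j ≠ k → ⟪v i, v j⟫ = T i j) :
    ∃ w : EuclideanSpace ℝ (Fin n), ⟪w, w⟫ = T k k ∧ ∀ j, j ≠ k → ⟪v j, w⟫ = T j k := by
  have : Nonempty (Fin n) := ⟨k⟩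
  let b := basisOfLinearIndependentOfCardEqFinrank hv (by simp)
  have hb : ∀ i, b i = v i := fun i => by simp [b]
  obtain ⟨w₀, hw₀⟩ := hv.exists_inner_eq fun j => T j k
  obtain ⟨f, hf⟩ := hv.exists_inner_eq fun j => if j = k then 1 else 0
  obtain ⟨u, hu⟩ := hT.exists_gram_eq
  have hu' : ∀ i j, ⟪u i, u j⟫ = T i j := fun i j => by rw [← hu]; rfl
  have hf0 : f ≠ 0 := fun h => by simpa [h] using hf k
  have hff : 0 < ⟪f, f⟫ := real_inner_self_pos.2 hf0
  -- Adding multiples of the dual vector `f` changes only the product with `v k`. Thus `q` is the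
  -- shortest candidate, and it lies in the span of the `v j` with `j ≠ k`.
  set q := w₀ - (⟪w₀, f⟫ / ⟪f, f⟫) • f with hq
  have hqf : ⟪q, f⟫ = 0 := by
    rw [hq, inner_sub_left, real_inner_smul_left]; field_simp; ring
  have hvq : ∀ j, j ≠ k → ⟪v j, q⟫ = T j k := fun j hj => by
    rw [hq, inner_sub_right, real_inner_smul_right, hf j, hw₀ j]; simp [hj]
  set c := b.repr q with hc
  have hqc : q = ∑ i, c i • v i := by
    simpa only [hb] using (b.sum_repr q).symm
  have hck : c k = 0 := by
    have : ⟪q, f⟫ = c k := by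
      conv_lhs => rw [hqc, sum_inner]
      simp [real_inner_smul_left, hf]
    rw [← this, hqf]
  -- The copy of `q` inside a realisation of `T`. It is the projection of `u k`, so `‖p - u k‖² ≥ 0`
  -- says that the Schur complement `T k k - ⟪q, q⟫` is nonnegative; this leaves room to lengthen
  -- `q` along `f`.
  set p := ∑ i, c i • u i with hp
  have hpq : ⟪p, p⟫ = ⟪q, q⟫ := by
    rw [hqc, hp]
    simp only [sum_inner, inner_sum, real_inner_smul_left, real_inner_smul_right, hu']
    refine Finset.sum_congr rfl fun i _ => Finset.sum_congr rfl fun j _ => ?_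
    by_cases hi : i = k
    · simp [hi, hck]
    by_cases hj : j = k
    · simp [hj, hck]
    rw [hTv _ _ hj hi]
  have hpu : ⟪p, u k⟫ = ⟪q, q⟫ := by
    have hqq : ⟪q, q⟫ = ∑ i, c i * ⟪v i, q⟫ := by
      simp only [← real_inner_smul_left, ← sum_inner, ← hqc]
    rw [hqq, hp, sum_inner]
    simp only [real_inner_smul_left, hu']
    refine Finset.sum_congr rfl fun i _ => ?_
    by_cases hi : i = k
    · simp [hi, hck]
    rw [hvq i hi]
  have hle : ⟪q, q⟫ ≤ T k k := by
    have h := real_inner_self_nonneg (x := p - u k)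
    rw [inner_sub_left, inner_sub_right, inner_sub_right, real_inner_comm p (u k), hpq, hpu,
      hu'] at h
    linarith
  refine ⟨q + √((T k k - ⟪q, q⟫) / ⟪f, f⟫) • f, ?_, fun j hj => ?_⟩
  · simp only [inner_add_left, inner_add_right, real_inner_smul_left, real_inner_smul_right,
      hqf, real_inner_comm q f]
    rw [← mul_assoc, Real.mul_self_sqrt (div_nonneg (by linarith) hff.le)]
    field_simp; ring
  · rw [inner_add_right, real_inner_smul_right, hf j, hvq j hj]; simp [hj]

end Gram

/-! ### Orthant probabilities as functions of the dispersion matrix -/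

section OrthantProb

open scoped RealInnerProductSpace

variable {n : ℕ} {ν : Measure (EuclideanSpace ℝ (Fin n))} {φ : ℝ → ℝ}

/-- Vectors whose Gram matrix is the given positive semidefinite matrix. -/
noncomputable def gramVectors (S : Matrix (Fin n) (Fin n) ℝ) :
    Fin n → EuclideanSpace ℝ (Fin n) :=
  open Classical in if h : S.PosSemidef then h.exists_gram_eq.choose else 0

theorem gram_gramVectors {S : Matrix (Fin n) (Fin n) ℝ} (hS : S.PosSemidef) :
    gram ℝ (gramVectors S) = S := by
  rw [gramVectors, dif_pos hS]
  exact hS.exists_gram_eq.choose_spec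

/-- The linear map `z ↦ (⟪v i, z⟫)ᵢ`. -/
noncomputable def innerMap (v : Fin n → EuclideanSpace ℝ (Fin n))
    (z : EuclideanSpace ℝ (Fin n)) : EuclideanSpace ℝ (Fin n) :=
  WithLp.toLp 2 fun i => ⟪v i, z⟫

theorem continuous_innerMap (v : Fin n → EuclideanSpace ℝ (Fin n)) : Continuous (innerMap v) := by
  unfold innerMap; fun_prop

theorem inner_innerMap (v : Fin n → EuclideanSpace ℝ (Fin n)) (z t : EuclideanSpace ℝ (Fin n)) :
    ⟪innerMap v z, t⟫ = ⟪z, ∑ i, t i • v i⟫ := by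
  rw [inner_sum, PiLp.inner_apply]
  refine Finset.sum_congr rfl fun i _ => ?_
  rw [real_inner_smul_right, real_inner_comm (v i)]
  rfl

theorem norm_sq_sum_smul (v : Fin n → EuclideanSpace ℝ (Fin n)) (t : Fin n → ℝ) :
    ‖∑ i, t i • v i‖ ^ 2 = t ⬝ᵥ (gram ℝ v *ᵥ t) := by
  have h := star_dotProduct_gram_mulVec (𝕜 := ℝ) v t t
  rw [star_trivial] at h
  rw [h, real_inner_self_eq_norm_sq]

theorem charFun_map_innerMap (v : Fin n → EuclideanSpace ℝ (Fin n))
    (t : EuclideanSpace ℝ (Fin n)) :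
    charFun (ν.map (innerMap v)) t = charFun ν (∑ i, t i • v i) := by
  simp only [charFun_apply]
  rw [integral_map (continuous_innerMap v).measurable.aemeasurable (by fun_prop)]
  simp only [inner_innerMap]

theorem charFun_map_innerMap_eq (hν : ∀ t, charFun ν t = (φ (‖t‖ ^ 2) : ℂ))
    (v : Fin n → EuclideanSpace ℝ (Fin n)) (t : EuclideanSpace ℝ (Fin n)) :
    charFun (ν.map (innerMap v)) t = (φ (t.ofLp ⬝ᵥ (gram ℝ v *ᵥ t.ofLp)) : ℂ) := by
  rw [charFun_map_innerMap, hν, norm_sq_sum_smul]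

theorem map_innerMap_eq_of_gram_eq [IsProbabilityMeasure ν]
    (hν : ∀ t, charFun ν t = (φ (‖t‖ ^ 2) : ℂ))
    {v w : Fin n → EuclideanSpace ℝ (Fin n)} (h : gram ℝ v = gram ℝ w) :
    ν.map (innerMap v) = ν.map (innerMap w) := by
  refine Measure.ext_of_charFun (funext fun t => ?_)
  rw [charFun_map_innerMap_eq hν, charFun_map_innerMap_eq hν, h]

theorem isRotationInvariant_of_charFun_eq [IsProbabilityMeasure ν]
    (hν : ∀ t, charFun ν t = (φ (‖t‖ ^ 2) : ℂ)) : IsRotationInvariant ν := fun g => by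
  have : IsProbabilityMeasure (ν.map g) :=
    Measure.isProbabilityMeasure_map g.continuous.measurable.aemeasurable
  refine Measure.ext_of_charFun (funext fun t => ?_)
  have : charFun (ν.map g) t = charFun ν (g.symm t) := by
    simp only [charFun_apply]
    rw [integral_map g.continuous.measurable.aemeasurable (by fun_prop)]
    congr with z
    rw [← g.inner_map_map z, g.apply_symm_apply]
  rw [this, hν, hν, g.symm.norm_map]

/-- The probability that a centred elliptical vector with dispersion matrix `S`, obtained from
the spherical distribution `ν`, has its coordinates in the sets `L i`. -/
noncomputable def orthantProb (ν : Measure (EuclideanSpace ℝ (Fin n)))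
    (S : Matrix (Fin n) (Fin n) ℝ) (L : Fin n → Set ℝ) : ENNReal :=
  ν (innerBox (gramVectors S) L)

theorem measure_innerBox_eq_map {L : Fin n → Set ℝ} (hL : ∀ i, MeasurableSet (L i))
    (v : Fin n → EuclideanSpace ℝ (Fin n)) :
    ν (innerBox v L) = ν.map (innerMap v) {x | ∀ i, x i ∈ L i} := by
  have : MeasurableSet {x : EuclideanSpace ℝ (Fin n) | ∀ i, x i ∈ L i} := by
    rw [Set.ofPred_forall]
    exact MeasurableSet.iInter fun i =>
      (by fun_prop : Continuous fun x : EuclideanSpace ℝ (Fin n) => x i).measurable (hL i)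
  rw [Measure.map_apply (continuous_innerMap v).measurable this]
  rfl

/-- The law of the inner products depends on the vectors only through their Gram matrix, so the
choice made in `gramVectors` is immaterial. -/
theorem measure_innerBox_eq_orthantProb [IsProbabilityMeasure ν]
    (hν : ∀ t, charFun ν t = (φ (‖t‖ ^ 2) : ℂ)) {L : Fin n → Set ℝ}
    (hL : ∀ i, MeasurableSet (L i)) (v : Fin n → EuclideanSpace ℝ (Fin n)) :
    ν (innerBox v L) = orthantProb ν (gram ℝ v) L := by
  rw [orthantProb, measure_innerBox_eq_map hL, measure_innerBox_eq_map hL,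
    map_innerMap_eq_of_gram_eq hν (gram_gramVectors (posSemidef_gram ℝ v)).symm]

/-- `S` and `T` agree up to an increase of the off-diagonal entries of the row and the column
with index `k`. -/
structure RowIncrease (k : Fin n) (S T : Matrix (Fin n) (Fin n) ℝ) : Prop where
  posDef : S.PosDef
  posSemidef : T.PosSemidef
  eq_of_ne : ∀ i j, i ≠ k → j ≠ k → S i j = T i j
  diag_eq : S k k = T k k
  le : ∀ j, j ≠ k → S j k ≤ T j k

theorem RowIncrease.exists_replacement {k : Fin n} {S T : Matrix (Fin n) (Fin n) ℝ}
    (h : RowIncrease k S T) :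
    ∃ w : EuclideanSpace ℝ (Fin n), ‖gramVectors S k‖ = ‖w‖ ∧
      (∀ j, j ≠ k → ⟪gramVectors S j, w⟫ = T j k) ∧
      gram ℝ (Function.update (gramVectors S) k w) = T := by
  have hg := gram_gramVectors h.posDef.posSemidef
  set v := gramVectors S
  have hv : ∀ i j, ⟪v i, v j⟫ = S i j := fun i j => by rw [← hg]; rfl
  have hli : LinearIndependent ℝ v := linearIndependent_of_posDef_gram (by rw [hg]; exact h.posDef)
  obtain ⟨w, hw, hvw⟩ := hli.exists_replacement h.posSemidef k fun i j hi hj => by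
    rw [hv, h.eq_of_ne i j hi hj]
  have hT : ∀ i j, T i j = T j i := fun i j => by simpa using h.posSemidef.1.apply j i
  refine ⟨w, ?_, hvw, ?_⟩
  · have : ‖v k‖ ^ 2 = ‖w‖ ^ 2 := by
      rw [← real_inner_self_eq_norm_sq, ← real_inner_self_eq_norm_sq, hv, hw, h.diag_eq]
    exact (sq_eq_sq₀ (norm_nonneg _) (norm_nonneg _)).1 this
  · ext i j
    rw [gram_apply]
    rcases eq_or_ne i k with rfl | hi <;> rcases eq_or_ne j i with rfl | hj
    · simpa using hw
    · rw [Function.update_self, Function.update_of_ne hj, real_inner_comm, hvw j hj, hT]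
    · rw [Function.update_of_ne hi, hv, h.eq_of_ne _ _ hi hi]
    · rcases eq_or_ne j k with rfl | hjk
      · rw [Function.update_self, Function.update_of_ne hi, hvw i hi]
      · rw [Function.update_of_ne hi, Function.update_of_ne hjk, hv, h.eq_of_ne _ _ hi hjk]

theorem RowIncrease.orthantProb_le [IsProbabilityMeasure ν]
    (hν : ∀ t, charFun ν t = (φ (‖t‖ ^ 2) : ℂ)) {L : Fin n → Set ℝ}
    (hL : ∀ i, IsLowerSet (L i)) {k : Fin n} {S T : Matrix (Fin n) (Fin n) ℝ}
    (h : RowIncrease k S T) : orthantProb ν S L ≤ orthantProb ν T L := by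
  obtain ⟨w, hw, hvw, hg⟩ := h.exists_replacement
  have hS := gram_gramVectors h.posDef.posSemidef
  conv_rhs => rw [← hg, ← measure_innerBox_eq_orthantProb hν
    fun i => (hL i).ordConnected.measurableSet]
  refine (isRotationInvariant_of_charFun_eq hν).measure_innerBox_le_update hL hw fun j hj => ?_
  rw [hvw j hj, ← gram_apply, hS]
  exact h.le j hj

theorem RowIncrease.orthantProb_lt [IsProbabilityMeasure ν]
    (hν : ∀ t, charFun ν t = (φ (‖t‖ ^ 2) : ℂ)) (hb : ¬ Bornology.IsBounded ν.support)
    {L : Fin n → Set ℝ} (hL : ∀ i, IsLowerSet (L i)) (hL₁ : ∀ i, (L i).Nonempty)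
    (hL₂ : ∀ i, L i ≠ Set.univ) {k : Fin n} {S T : Matrix (Fin n) (Fin n) ℝ}
    (h : RowIncrease k S T) {l : Fin n} (hl : l ≠ k) (hlt : S l k < T l k) :
    orthantProb ν S L < orthantProb ν T L := by
  obtain ⟨w, hw, hvw, hg⟩ := h.exists_replacement
  have hS := gram_gramVectors h.posDef.posSemidef
  have hli : LinearIndependent ℝ (gramVectors S) :=
    linearIndependent_of_posDef_gram (by rw [hS]; exact h.posDef)
  -- Any direction along which all coordinates decrease would serve.
  obtain ⟨f, hf⟩ := hli.exists_inner_eq fun _ => -1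
  conv_rhs => rw [← hg, ← measure_innerBox_eq_orthantProb hν
    fun i => (hL i).ordConnected.measurableSet]
  refine (isRotationInvariant_of_charFun_eq hν).measure_innerBox_lt_update hb hL hL₁ hL₂
    (f := f) (fun i => by rw [hf i]; norm_num) hw (fun j hj => ?_) hl ?_
  · rw [hvw j hj, ← gram_apply, hS]
    exact h.le j hj
  · rwa [hvw l hl, ← gram_apply, hS]

end OrthantProb

/-! ### From one matrix to another through positive definite ones -/

section Chain

open Filter Topology

variable {n : ℕ}

/-- The quadratic form is jointly continuous in `ε` and the vector, and positivity need only be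
tested on the compact unit sphere. -/
theorem Matrix.PosDef.eventually_add_smul {G M : Matrix (Fin n) (Fin n) ℝ} (hG : G.PosDef)
    (hM : M.IsHermitian) : ∀ᶠ ε : ℝ in 𝓝 0, (G + ε • M).PosDef := by
  have hcont : Continuous fun p : ℝ × (Fin n → ℝ) => p.2 ⬝ᵥ ((G + p.1 • M) *ᵥ p.2) := by
    simp only [dotProduct, mulVec]
    fun_prop
  have hsph : ∀ᶠ ε : ℝ in 𝓝 0, ∀ x ∈ Metric.sphere (0 : Fin n → ℝ) 1,
      0 < x ⬝ᵥ ((G + ε • M) *ᵥ x) := by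
    refine (isCompact_sphere (0 : Fin n → ℝ) 1).eventually_forall_of_forall_eventually
      fun x hx => ?_
    refine (hcont.tendsto (0, x)).eventually_const_lt ?_
    have hx0 : x ≠ 0 := by rintro rfl; simp at hx
    simpa using hG.dotProduct_mulVec_pos hx0
  filter_upwards [hsph] with ε hε
  refine .of_dotProduct_mulVec_pos (hG.1.add (hM.smul (IsSelfAdjoint.all ε))) fun x hx => ?_
  have hx' : 0 < ‖x‖ := norm_pos_iff.2 hx
  have h := hε (‖x‖⁻¹ • x) (by simp [norm_smul, hx'.ne'])
  rw [mulVec_smul, dotProduct_smul, smul_dotProduct, smul_eq_mul, smul_eq_mul] at h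
  rw [star_trivial]
  have h1 : 0 < ‖x‖⁻¹ := inv_pos.2 hx'
  exact (mul_pos_iff_of_pos_left h1).1 ((mul_pos_iff_of_pos_left h1).1 h)

/-- The entries of `D` in the rows and columns with indices in `T`. -/
def rowColPart (D : Matrix (Fin n) (Fin n) ℝ) (T : Finset (Fin n)) : Matrix (Fin n) (Fin n) ℝ :=
  of fun i j => if i ∈ T ∨ j ∈ T then D i j else 0

@[simp]
theorem rowColPart_apply (D : Matrix (Fin n) (Fin n) ℝ) (T : Finset (Fin n)) (i j : Fin n) :
    rowColPart D T i j = if i ∈ T ∨ j ∈ T then D i j else 0 := rfl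

theorem rowColPart_empty (D : Matrix (Fin n) (Fin n) ℝ) : rowColPart D ∅ = 0 := by
  ext i j; simp

theorem rowColPart_univ (D : Matrix (Fin n) (Fin n) ℝ) : rowColPart D Finset.univ = D := by
  ext i j; simp

theorem isHermitian_rowColPart {D : Matrix (Fin n) (Fin n) ℝ} (hD : D.IsHermitian)
    (T : Finset (Fin n)) : (rowColPart D T).IsHermitian := by
  ext i j
  have := hD.apply i j
  simp only [star_trivial] at this
  simp [this, or_comm]

theorem rowIncrease_rowColPart {S D : Matrix (Fin n) (Fin n) ℝ} {ε : ℝ} (hε : 0 ≤ ε)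
    (hPD : ∀ T, (S + ε • rowColPart D T).PosDef) (hdiag : ∀ i, D i i = 0)
    (hnn : ∀ i j, 0 ≤ D i j) (k : Fin n) (T : Finset (Fin n)) :
    RowIncrease k (S + ε • rowColPart D T) (S + ε • rowColPart D (insert k T)) where
  posDef := hPD T
  posSemidef := (hPD _).posSemidef
  eq_of_ne i j hi hj := by simp [hi, hj]
  diag_eq := by simp [hdiag]
  le j hj := by
    have := mul_nonneg hε (hnn j k)
    by_cases h : j ∈ T <;> by_cases h' : k ∈ T <;> simp [h, h', this]

variable {ν : Measure (EuclideanSpace ℝ (Fin n))} [IsProbabilityMeasure ν] {φ : ℝ → ℝ}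

/-- Enlarging the index set of `rowColPart` by one element is a single `RowIncrease`, so induction
on `U` chains these. -/
theorem orthantProb_add_smul_rowColPart_le (hν : ∀ t, charFun ν t = (φ (‖t‖ ^ 2) : ℂ))
    {L : Fin n → Set ℝ} (hL : ∀ i, IsLowerSet (L i))
    {S D : Matrix (Fin n) (Fin n) ℝ} {ε : ℝ} (hε : 0 ≤ ε)
    (hPD : ∀ T, (S + ε • rowColPart D T).PosDef) (hdiag : ∀ i, D i i = 0)
    (hnn : ∀ i j, 0 ≤ D i j) (T U : Finset (Fin n)) :
    orthantProb ν (S + ε • rowColPart D T) L ≤ orthantProb ν (S + ε • rowColPart D (U ∪ T)) L := by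
  induction U using Finset.induction_on with
  | empty => simp
  | insert k U _ ih =>
    rw [Finset.insert_union]
    exact ih.trans ((rowIncrease_rowColPart hε hPD hdiag hnn k _).orthantProb_le hν hL)

theorem orthantProb_le_add_smul (hν : ∀ t, charFun ν t = (φ (‖t‖ ^ 2) : ℂ))
    {L : Fin n → Set ℝ} (hL : ∀ i, IsLowerSet (L i))
    {S D : Matrix (Fin n) (Fin n) ℝ} {ε : ℝ} (hε : 0 ≤ ε)
    (hPD : ∀ T, (S + ε • rowColPart D T).PosDef) (hdiag : ∀ i, D i i = 0)
    (hnn : ∀ i j, 0 ≤ D i j) :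
    orthantProb ν S L ≤ orthantProb ν (S + ε • D) L := by
  simpa [rowColPart_empty, rowColPart_univ] using
    orthantProb_add_smul_rowColPart_le hν hL hε hPD hdiag hnn ∅ Finset.univ

theorem orthantProb_lt_add_smul (hν : ∀ t, charFun ν t = (φ (‖t‖ ^ 2) : ℂ))
    (hb : ¬ Bornology.IsBounded ν.support)
    {L : Fin n → Set ℝ} (hL : ∀ i, IsLowerSet (L i)) (hL₁ : ∀ i, (L i).Nonempty)
    (hL₂ : ∀ i, L i ≠ Set.univ) {S D : Matrix (Fin n) (Fin n) ℝ} {ε : ℝ} (hε : 0 < ε)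
    (hPD : ∀ T, (S + ε • rowColPart D T).PosDef) (hdiag : ∀ i, D i i = 0)
    (hnn : ∀ i j, 0 ≤ D i j) {l k : Fin n} (hlk : 0 < D l k) :
    orthantProb ν S L < orthantProb ν (S + ε • D) L := by
  have hl : l ≠ k := by rintro rfl; rw [hdiag] at hlk; exact lt_irrefl _ hlk
  -- Row `k` is changed first, when its entry `l` still has to grow; the remaining rows cost
  -- nothing.
  have h1 := (rowIncrease_rowColPart hε.le hPD hdiag hnn k ∅).orthantProb_lt hν hb hL hL₁ hL₂ hl
    (by simpa using mul_pos hε hlk)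
  have h2 := orthantProb_add_smul_rowColPart_le hν hL hε.le hPD hdiag hnn (insert k ∅) Finset.univ
  rw [rowColPart_empty, smul_zero, add_zero] at h1
  rw [Finset.union_eq_left.2 (Finset.subset_univ _), rowColPart_univ] at h2
  exact h1.trans_le h2

/-- A subdivision of the segment from `S` to `S + D` into steps for which all the intermediate
matrices are positive definite. -/
theorem exists_subdivision {G S D : Matrix (Fin n) (Fin n) ℝ} (hG : G.PosDef)
    (hS : (S - G).PosSemidef) (hSD : (S + D - G).PosSemidef) (hD : D.IsHermitian) :
    ∃ N : ℕ, 0 < N ∧ ∀ m < N, ∀ T,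
      (S + ((m : ℝ) / N) • D + (1 / N : ℝ) • rowColPart D T).PosDef := by
  have hev : ∀ᶠ ε : ℝ in 𝓝 0, ∀ T, (G + ε • rowColPart D T).PosDef :=
    eventually_all.2 fun T => hG.eventually_add_smul (isHermitian_rowColPart hD T)
  obtain ⟨N, hN, hN0⟩ :=
    ((tendsto_one_div_atTop_nhds_zero_nat (𝕜 := ℝ)).eventually hev |>.and
      (eventually_gt_atTop 0)).exists
  refine ⟨N, hN0, fun m hm T => ?_⟩
  have hNr : (0 : ℝ) < N := by exact_mod_cast hN0
  have hm1 : (m : ℝ) / N ≤ 1 := by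
    rw [div_le_one hNr]; exact_mod_cast hm.le
  -- A small perturbation of `G` plus a convex combination of the excesses of the two endpoints over
  -- `G`.
  have hdec : S + ((m : ℝ) / N) • D + (1 / N : ℝ) • rowColPart D T =
      (G + (1 / N : ℝ) • rowColPart D T) +
        ((1 - (m : ℝ) / N) • (S - G) + ((m : ℝ) / N) • (S + D - G)) := by
    module
  rw [hdec]
  exact (hN T).add_posSemidef ((hS.smul (sub_nonneg.2 hm1)).add (hSD.smul (by positivity)))

theorem orthantProb_le_of_posDef (hν : ∀ t, charFun ν t = (φ (‖t‖ ^ 2) : ℂ))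
    {L : Fin n → Set ℝ} (hL : ∀ i, IsLowerSet (L i)) {G S D : Matrix (Fin n) (Fin n) ℝ}
    (hG : G.PosDef) (hS : (S - G).PosSemidef) (hSD : (S + D - G).PosSemidef) (hD : D.IsHermitian)
    (hdiag : ∀ i, D i i = 0) (hnn : ∀ i j, 0 ≤ D i j) :
    orthantProb ν S L ≤ orthantProb ν (S + D) L := by
  obtain ⟨N, hN0, hN⟩ := exists_subdivision hG hS hSD hD
  have hNr : (N : ℝ) ≠ 0 := by exact_mod_cast hN0.ne'
  have key : ∀ m ≤ N, orthantProb ν S L ≤ orthantProb ν (S + ((m : ℝ) / N) • D) L := by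
    intro m
    induction m with
    | zero => simp
    | succ m ih =>
      intro hm
      refine (ih (by omega)).trans ?_
      have h := orthantProb_le_add_smul hν hL (by positivity) (hN m hm) hdiag hnn
      rwa [add_assoc, ← add_smul, ← add_div, ← Nat.cast_succ] at h
  simpa [div_self hNr] using key N le_rfl

theorem orthantProb_lt_of_posDef (hν : ∀ t, charFun ν t = (φ (‖t‖ ^ 2) : ℂ))
    (hb : ¬ Bornology.IsBounded ν.support)
    {L : Fin n → Set ℝ} (hL : ∀ i, IsLowerSet (L i)) (hL₁ : ∀ i, (L i).Nonempty)
    (hL₂ : ∀ i, L i ≠ Set.univ) {G S D : Matrix (Fin n) (Fin n) ℝ}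
    (hG : G.PosDef) (hS : (S - G).PosSemidef) (hSD : (S + D - G).PosSemidef) (hD : D.IsHermitian)
    (hdiag : ∀ i, D i i = 0) (hnn : ∀ i j, 0 ≤ D i j) {l k : Fin n} (hlk : 0 < D l k) :
    orthantProb ν S L < orthantProb ν (S + D) L := by
  obtain ⟨N, hN0, hN⟩ := exists_subdivision hG hS hSD hD
  have hNr : (N : ℝ) ≠ 0 := by exact_mod_cast hN0.ne'
  have hNpos : (0 : ℝ) < 1 / N := by positivity
  have key : ∀ m < N, orthantProb ν S L < orthantProb ν (S + (((m + 1 : ℕ) : ℝ) / N) • D) L := by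
    intro m
    have hstep : ∀ m < N, orthantProb ν (S + ((m : ℝ) / N) • D) L <
        orthantProb ν (S + (((m + 1 : ℕ) : ℝ) / N) • D) L := fun m hm => by
      have h := orthantProb_lt_add_smul hν hb hL hL₁ hL₂ hNpos (hN m hm) hdiag hnn hlk
      rwa [add_assoc, ← add_smul, ← add_div, ← Nat.cast_succ] at h
    induction m with
    | zero => intro hm; simpa using hstep 0 hm
    | succ m ih => intro hm; exact (ih (by omega)).trans (hstep (m + 1) hm)
  have h := key (N - 1) (by omega)
  rwa [Nat.sub_add_cancel hN0, div_self hNr, one_smul] at h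

end Chain

/-! ### Singular dispersion matrices by weak limits -/

section Singular

open Filter Topology
open scoped RealInnerProductSpace

variable {n : ℕ} {ν : Measure (EuclideanSpace ℝ (Fin n))} [IsProbabilityMeasure ν] {φ : ℝ → ℝ}

omit [IsProbabilityMeasure ν] in
theorem generator_eq_re_charFun (hν : ∀ t, charFun ν t = (φ (‖t‖ ^ 2) : ℂ)) (i : Fin n) {u : ℝ}
    (hu : 0 ≤ u) : φ u = (charFun ν (EuclideanSpace.single i √u)).re := by
  rw [hν, Complex.ofReal_re]
  simp [Real.sq_sqrt hu]

/-- On `[0, ∞)` the generator is read off the characteristic function along a coordinate axis. The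
index `i` excludes dimension zero, where only `φ 0` is visible. -/
theorem continuousOn_generator (hν : ∀ t, charFun ν t = (φ (‖t‖ ^ 2) : ℂ)) (i : Fin n) :
    ContinuousOn φ (Set.Ici 0) := by
  have hc : Continuous fun u : ℝ => (charFun ν (EuclideanSpace.single i √u)).re := by
    have h1 : Continuous (charFun ν) := by fun_prop
    have h2 : Continuous fun u : ℝ => EuclideanSpace.single i √u := by
      have : (fun u : ℝ => EuclideanSpace.single i √u) =
          fun u : ℝ => √u • EuclideanSpace.single i (1 : ℝ) := by
        ext u j; simp [PiLp.single_apply]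
      rw [this]
      fun_prop
    exact Complex.continuous_re.comp (h1.comp h2)
  exact hc.continuousOn.congr fun u hu => generator_eq_re_charFun hν i hu

theorem generator_zero (hν : ∀ t, charFun ν t = (φ (‖t‖ ^ 2) : ℂ)) : φ 0 = 1 := by
  have h := hν 0
  rw [charFun_zero] at h
  simp only [probReal_univ, norm_zero] at h
  norm_num at h
  exact_mod_cast h.symm

/-- The centred elliptical distribution with dispersion matrix `S`. -/
noncomputable def ellipticalLaw (ν : Measure (EuclideanSpace ℝ (Fin n))) [IsProbabilityMeasure ν]
    (S : Matrix (Fin n) (Fin n) ℝ) : ProbabilityMeasure (EuclideanSpace ℝ (Fin n)) :=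
  ⟨ν.map (innerMap (gramVectors S)),
    Measure.isProbabilityMeasure_map (continuous_innerMap _).measurable.aemeasurable⟩

theorem charFun_ellipticalLaw (hν : ∀ t, charFun ν t = (φ (‖t‖ ^ 2) : ℂ))
    {S : Matrix (Fin n) (Fin n) ℝ} (hS : S.PosSemidef) (t : EuclideanSpace ℝ (Fin n)) :
    charFun (ellipticalLaw ν S : Measure (EuclideanSpace ℝ (Fin n))) t =
      (φ (t.ofLp ⬝ᵥ (S *ᵥ t.ofLp)) : ℂ) := by
  conv_rhs => rw [← gram_gramVectors hS]
  exact charFun_map_innerMap_eq hν _ t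

/-- Lévy's continuity theorem, with continuity of `φ` used only within `[0, ∞)`, where the quadratic
forms take their values. -/
theorem tendsto_ellipticalLaw (hν : ∀ t, charFun ν t = (φ (‖t‖ ^ 2) : ℂ))
    {S : Matrix (Fin n) (Fin n) ℝ} (hS : S.PosSemidef) :
    Tendsto (fun m : ℕ => ellipticalLaw ν (S + (1 / ((m : ℝ) + 1)) • 1)) atTop
      (𝓝 (ellipticalLaw ν S)) := by
  refine ProbabilityMeasure.tendsto_of_tendsto_charFun fun t => ?_
  have hpsd : ∀ m : ℕ, (S + (1 / ((m : ℝ) + 1)) • (1 : Matrix (Fin n) (Fin n) ℝ)).PosSemidef :=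
    fun m => hS.add (PosSemidef.one.smul (by positivity))
  simp only [charFun_ellipticalLaw hν hS, charFun_ellipticalLaw hν (hpsd _)]
  rcases n.eq_zero_or_pos with rfl | hn
  · simp
  have hnn : ∀ {M : Matrix (Fin n) (Fin n) ℝ}, M.PosSemidef →
      t.ofLp ⬝ᵥ (M *ᵥ t.ofLp) ∈ Set.Ici (0 : ℝ) := fun hM => by
    simpa using hM.dotProduct_mulVec_nonneg t.ofLp
  have hlim : Tendsto (fun m : ℕ => t.ofLp ⬝ᵥ ((S + (1 / ((m : ℝ) + 1)) • 1) *ᵥ t.ofLp)) atTop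
      (𝓝 (t.ofLp ⬝ᵥ (S *ᵥ t.ofLp))) := by
    have h := (tendsto_one_div_add_atTop_nhds_zero_nat (𝕜 := ℝ)).mul_const (t.ofLp ⬝ᵥ t.ofLp)
    have h' := h.const_add (t.ofLp ⬝ᵥ (S *ᵥ t.ofLp))
    simpa [add_mulVec, smul_mulVec, dotProduct_add, dotProduct_smul] using h'
  exact (Complex.continuous_ofReal.tendsto _).comp
    (((continuousOn_generator hν ⟨0, hn⟩) _ (hnn hS)).tendsto.comp
      (tendsto_nhdsWithin_iff.2 ⟨hlim, Eventually.of_forall fun m => hnn (hpsd m)⟩))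

theorem orthantProb_eq_ellipticalLaw {L : Fin n → Set ℝ} (hL : ∀ i, MeasurableSet (L i))
    (S : Matrix (Fin n) (Fin n) ℝ) :
    orthantProb ν S L =
      (ellipticalLaw ν S : Measure (EuclideanSpace ℝ (Fin n))) {x | ∀ i, x i ∈ L i} :=
  measure_innerBox_eq_map hL _

/-- The comparison of orthant probabilities for singular dispersion matrices, with a margin. -/
theorem orthantProb_Iic_le_of_lt (hν : ∀ t, charFun ν t = (φ (‖t‖ ^ 2) : ℂ))
    {S D : Matrix (Fin n) (Fin n) ℝ} (hS : S.PosSemidef) (hSD : (S + D).PosSemidef)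
    (hdiag : ∀ i, D i i = 0) (hnn : ∀ i j, 0 ≤ D i j) {a b : Fin n → ℝ} (hab : ∀ i, a i < b i) :
    orthantProb ν S (fun i => Set.Iic (a i)) ≤ orthantProb ν (S + D) (fun i => Set.Iic (b i)) := by
  have hD : D.IsHermitian := by simpa using hSD.1.sub hS.1
  have hlaw : ∀ m : ℕ,
      orthantProb ν (S + (1 / ((m : ℝ) + 1)) • 1) (fun i => Set.Iio (b i)) ≤
        orthantProb ν (S + D + (1 / ((m : ℝ) + 1)) • 1) (fun i => Set.Iic (b i)) := fun m => by
    have hpos : (0 : ℝ) < 1 / ((m : ℝ) + 1) := by positivity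
    have h := orthantProb_le_of_posDef (ν := ν) hν (L := fun i => Set.Iio (b i))
      (fun i => isLowerSet_Iio _) (PosDef.one.smul hpos)
      (S := S + (1 / ((m : ℝ) + 1)) • 1) (D := D) (by simpa using hS)
      (by rw [add_right_comm, add_sub_cancel_right]; exact hSD) hD hdiag hnn
    rw [add_right_comm] at h
    exact h.trans (measure_mono (innerBox_mono _ fun i => Set.Iio_subset_Iic_self))
  have hopen : IsOpen {x : EuclideanSpace ℝ (Fin n) | ∀ i, x i ∈ Set.Iio (b i)} := by
    rw [Set.ofPred_forall]
    exact isOpen_iInter_of_finite fun i => isOpen_Iio.preimage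
      (by fun_prop : Continuous fun x : EuclideanSpace ℝ (Fin n) => x i)
  have hclosed : IsClosed {x : EuclideanSpace ℝ (Fin n) | ∀ i, x i ∈ Set.Iic (b i)} := by
    rw [Set.ofPred_forall]
    exact isClosed_iInter fun i => isClosed_Iic.preimage
      (by fun_prop : Continuous fun x : EuclideanSpace ℝ (Fin n) => x i)
  -- The portmanteau theorem bounds open sets from below and closed sets from above; the gap between
  -- `a` and `b` allows an open orthant in between, so atoms on the boundary do no harm.
  calc orthantProb ν S (fun i => Set.Iic (a i))
      ≤ orthantProb ν S (fun i => Set.Iio (b i)) :=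
        measure_mono (innerBox_mono _ fun i => Set.Iic_subset_Iio.2 (hab i))
    _ ≤ liminf (fun m : ℕ =>
          orthantProb ν (S + (1 / ((m : ℝ) + 1)) • 1) (fun i => Set.Iio (b i))) atTop := by
        simp only [orthantProb_eq_ellipticalLaw fun i => measurableSet_Iio]
        exact ProbabilityMeasure.le_liminf_measure_open_of_tendsto (tendsto_ellipticalLaw hν hS)
          hopen
    _ ≤ limsup (fun m : ℕ =>
          orthantProb ν (S + (1 / ((m : ℝ) + 1)) • 1) (fun i => Set.Iio (b i))) atTop :=
        liminf_le_limsup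
    _ ≤ limsup (fun m : ℕ =>
          orthantProb ν (S + D + (1 / ((m : ℝ) + 1)) • 1) (fun i => Set.Iic (b i))) atTop :=
        limsup_le_limsup (Eventually.of_forall hlaw)
    _ ≤ orthantProb ν (S + D) (fun i => Set.Iic (b i)) := by
        simp only [orthantProb_eq_ellipticalLaw fun i => measurableSet_Iic]
        exact ProbabilityMeasure.limsup_measure_closed_le_of_tendsto (tendsto_ellipticalLaw hν hSD)
          hclosed

theorem orthantProb_Iic_le (hν : ∀ t, charFun ν t = (φ (‖t‖ ^ 2) : ℂ))
    {S D : Matrix (Fin n) (Fin n) ℝ} (hS : S.PosSemidef) (hSD : (S + D).PosSemidef)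
    (hdiag : ∀ i, D i i = 0) (hnn : ∀ i j, 0 ≤ D i j) (a : Fin n → ℝ) :
    orthantProb ν S (fun i => Set.Iic (a i)) ≤ orthantProb ν (S + D) (fun i => Set.Iic (a i)) := by
  have hlim : Tendsto (fun m : ℕ => orthantProb ν (S + D)
      (fun i => Set.Iic (a i + 1 / ((m : ℝ) + 1)))) atTop
      (𝓝 (orthantProb ν (S + D) (fun i => Set.Iic (a i)))) := by
    have hInter : innerBox (gramVectors (S + D)) (fun i => Set.Iic (a i)) =
        ⋂ m : ℕ, innerBox (gramVectors (S + D)) (fun i => Set.Iic (a i + 1 / ((m : ℝ) + 1))) := by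
      ext z
      simp only [innerBox, Set.mem_iInter, Set.mem_ofPred_eq, Set.mem_Iic]
      refine ⟨fun h m i => (h i).trans (by simp; positivity), fun h i => ?_⟩
      have ht : Tendsto (fun m : ℕ => a i + 1 / ((m : ℝ) + 1)) atTop (𝓝 (a i)) := by
        simpa using (tendsto_one_div_add_atTop_nhds_zero_nat (𝕜 := ℝ)).const_add (a i)
      exact ge_of_tendsto' ht fun m => h m i
    unfold orthantProb
    rw [hInter]
    refine tendsto_measure_iInter_atTop (fun m => (measurableSet_innerBox _ fun i =>
      measurableSet_Iic).nullMeasurableSet) (fun m₁ m₂ h => innerBox_mono _ fun i => ?_)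
      ⟨0, measure_ne_top _ _⟩
    refine Set.Iic_subset_Iic.2 ?_
    gcongr
  exact ge_of_tendsto' hlim fun m =>
    orthantProb_Iic_le_of_lt hν hS hSD hdiag hnn fun i => by simp; positivity

theorem orthantProb_Iio_le (hν : ∀ t, charFun ν t = (φ (‖t‖ ^ 2) : ℂ))
    {S D : Matrix (Fin n) (Fin n) ℝ} (hS : S.PosSemidef) (hSD : (S + D).PosSemidef)
    (hdiag : ∀ i, D i i = 0) (hnn : ∀ i j, 0 ≤ D i j) (a : Fin n → ℝ) :
    orthantProb ν S (fun i => Set.Iio (a i)) ≤ orthantProb ν (S + D) (fun i => Set.Iio (a i)) := by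
  have hUnion : innerBox (gramVectors S) (fun i => Set.Iio (a i)) =
      ⋃ m : ℕ, innerBox (gramVectors S) (fun i => Set.Iic (a i - 1 / ((m : ℝ) + 1))) := by
    ext z
    simp only [innerBox, Set.mem_iUnion, Set.mem_ofPred_eq, Set.mem_Iic, Set.mem_Iio]
    refine ⟨fun h => ?_, fun ⟨m, h⟩ i => lt_of_le_of_lt (h i) (by simp; positivity)⟩
    have hev : ∀ᶠ m : ℕ in atTop, ∀ i, ⟪gramVectors S i, z⟫ ≤ a i - 1 / ((m : ℝ) + 1) :=
      eventually_all.2 fun i => by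
        have ht : Tendsto (fun m : ℕ => a i - 1 / ((m : ℝ) + 1)) atTop (𝓝 (a i)) := by
          simpa using (tendsto_one_div_add_atTop_nhds_zero_nat (𝕜 := ℝ)).const_sub (a i)
        exact (ht.eventually_const_lt (h i)).mono fun m hm => hm.le
    exact hev.exists
  have hmono : Monotone fun m : ℕ =>
      innerBox (gramVectors S) (fun i => Set.Iic (a i - 1 / ((m : ℝ) + 1))) :=
    fun m₁ m₂ h => innerBox_mono _ fun i => by
      refine Set.Iic_subset_Iic.2 ?_
      gcongr
  unfold orthantProb
  rw [hUnion, hmono.measure_iUnion]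
  refine iSup_le fun m => ?_
  -- The next term of the exhausting sequence supplies the margin and still lies below `a i`.
  refine (orthantProb_Iic_le_of_lt (ν := ν) hν hS hSD hdiag hnn
    (b := fun i => a i - 1 / (((m + 1 : ℕ) : ℝ) + 1)) fun i => ?_).trans
    (measure_mono (innerBox_mono _ fun i => Set.Iic_subset_Iio.2 ?_))
  · push_cast
    gcongr
    linarith
  · have : (0 : ℝ) < 1 / (((m + 1 : ℕ) : ℝ) + 1) := by positivity
    linarith

/-- Strict comparison for dispersion matrices whose sum is positive definite. The weak comparison
is used on the outer thirds of the segment between them. -/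
theorem orthantProb_lt_of_add_posDef (hν : ∀ t, charFun ν t = (φ (‖t‖ ^ 2) : ℂ))
    (hb : ¬ Bornology.IsBounded ν.support)
    {S D : Matrix (Fin n) (Fin n) ℝ} (hS : S.PosSemidef) (hSD : (S + D).PosSemidef)
    (hsum : (S + (S + D)).PosDef) (hdiag : ∀ i, D i i = 0) (hnn : ∀ i j, 0 ≤ D i j)
    {l k : Fin n} (hlk : 0 < D l k) {L : Fin n → Set ℝ} (hL : ∀ i, IsLowerSet (L i))
    (hL₁ : ∀ i, (L i).Nonempty) (hL₂ : ∀ i, L i ≠ Set.univ)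
    (hle : ∀ {S D : Matrix (Fin n) (Fin n) ℝ}, S.PosSemidef → (S + D).PosSemidef →
      (∀ i, D i i = 0) → (∀ i j, 0 ≤ D i j) → orthantProb ν S L ≤ orthantProb ν (S + D) L) :
    orthantProb ν S L < orthantProb ν (S + D) L := by
  have hD : D.IsHermitian := by simpa using hSD.1.sub hS.1
  have h3 : (0 : ℝ) < 1 / 3 := by norm_num
  have hdiag' : ∀ i, ((1 / 3 : ℝ) • D) i i = 0 := fun i => by simp [hdiag]
  have hnn' : ∀ i j, 0 ≤ ((1 / 3 : ℝ) • D) i j := fun i j => mul_nonneg h3.le (hnn i j)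
  have e1 : S + (1 / 3 : ℝ) • D = (2 / 3 : ℝ) • S + (1 / 3 : ℝ) • (S + D) := by module
  have e2 : S + (1 / 3 : ℝ) • D + (1 / 3 : ℝ) • D = (1 / 3 : ℝ) • S + (2 / 3 : ℝ) • (S + D) := by
    module
  have e3 : S + D = S + (1 / 3 : ℝ) • D + (1 / 3 : ℝ) • D + (1 / 3 : ℝ) • D := by module
  have p1 : (S + (1 / 3 : ℝ) • D).PosSemidef := by
    rw [e1]; exact (hS.smul (by norm_num)).add (hSD.smul h3.le)
  have p2 : (S + (1 / 3 : ℝ) • D + (1 / 3 : ℝ) • D).PosSemidef := by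
    rw [e2]; exact (hS.smul h3.le).add (hSD.smul (by norm_num))
  -- One third of the positive definite sum lies below both ends of the middle third, and serves as
  -- the lower bound `G`.
  have f1 : S + (1 / 3 : ℝ) • D - (1 / 3 : ℝ) • (S + (S + D)) = (1 / 3 : ℝ) • S := by module
  have f2 : S + (1 / 3 : ℝ) • D + (1 / 3 : ℝ) • D - (1 / 3 : ℝ) • (S + (S + D)) =
      (1 / 3 : ℝ) • (S + D) := by module
  calc orthantProb ν S L ≤ orthantProb ν (S + (1 / 3 : ℝ) • D) L := hle hS p1 hdiag' hnn'
    _ < orthantProb ν (S + (1 / 3 : ℝ) • D + (1 / 3 : ℝ) • D) L :=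
        orthantProb_lt_of_posDef hν hb hL hL₁ hL₂ (hsum.smul h3)
          (by rw [f1]; exact hS.smul h3.le) (by rw [f2]; exact hSD.smul h3.le)
          (hD.smul (IsSelfAdjoint.all _)) hdiag' hnn' (mul_pos h3 hlk)
    _ ≤ orthantProb ν (S + (1 / 3 : ℝ) • D + (1 / 3 : ℝ) • D + (1 / 3 : ℝ) • D) L :=
        hle p2 (by rw [← e3]; exact hSD) hdiag' hnn'
    _ = orthantProb ν (S + D) L := by rw [← e3]

end Singular

/-! ### Elliptical vectors and their marginals -/

section Elliptical

open Filter Topology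
open scoped RealInnerProductSpace

variable {Ω : Type*} [MeasurableSpace Ω] {P : Measure Ω} [IsProbabilityMeasure P] {n : ℕ}
  {X : Ω → EuclideanSpace ℝ (Fin n)} {m : EuclideanSpace ℝ (Fin n)}
  {S : Matrix (Fin n) (Fin n) ℝ} {φ : ℝ → ℝ}
  {ν : Measure (EuclideanSpace ℝ (Fin n))} [IsProbabilityMeasure ν]

theorem inner_eq_dotProduct (x y : EuclideanSpace ℝ (Fin n)) : ⟪x, y⟫ = y.ofLp ⬝ᵥ x.ofLp := by
  simp [EuclideanSpace.inner_eq_star_dotProduct]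

/-- An elliptical vector is distributed as an affine image of the spherical distribution. -/
theorem IsElliptical.map_eq (hX : IsElliptical X P m S φ)
    (hν : ∀ t, charFun ν t = (φ (‖t‖ ^ 2) : ℂ)) :
    P.map X = ν.map fun z => m + innerMap (gramVectors S) z := by
  have hc := continuous_innerMap (gramVectors S)
  have : IsProbabilityMeasure (P.map X) := Measure.isProbabilityMeasure_map hX.aemeasurable
  have : IsProbabilityMeasure (ν.map fun z => m + innerMap (gramVectors S) z) :=
    Measure.isProbabilityMeasure_map (by fun_prop)
  refine Measure.ext_of_charFun (funext fun t => ?_)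
  have hmap : (ν.map fun z => m + innerMap (gramVectors S) z) =
      (ν.map (innerMap (gramVectors S))).map fun z => m + z := by
    rw [Measure.map_map (by fun_prop) hc.measurable]; rfl
  rw [hmap, charFun_map_const_add, charFun_map_innerMap_eq hν, gram_gramVectors hX.posSemidef,
    hX.charFun_eq, inner_eq_dotProduct, mul_comm, mul_comm Complex.I]

theorem IsElliptical.measure_le_eq (hX : IsElliptical X P m S φ)
    (hν : ∀ t, charFun ν t = (φ (‖t‖ ^ 2) : ℂ)) (a : Fin n → ℝ) :
    P {ω | ∀ i, X ω i ≤ a i} = orthantProb ν S fun i => Set.Iic (a i - m i) := by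
  have hc := continuous_innerMap (gramVectors S)
  have hmeas : MeasurableSet {x : EuclideanSpace ℝ (Fin n) | ∀ i, x i ≤ a i} := by
    rw [Set.ofPred_forall]
    exact MeasurableSet.iInter fun i => measurableSet_le (by fun_prop) measurable_const
  have h := congrArg (fun μ => μ {x : EuclideanSpace ℝ (Fin n) | ∀ i, x i ≤ a i}) (hX.map_eq hν)
  simp only [Measure.map_apply_of_aemeasurable hX.aemeasurable hmeas,
    Measure.map_apply (by fun_prop : Measurable fun z => m + innerMap (gramVectors S) z) hmeas] at h
  refine h.trans (congrArg ν ?_)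
  ext z
  simp [innerBox, innerMap, le_sub_iff_add_le']

theorem IsElliptical.measure_lt_eq (hX : IsElliptical X P m S φ)
    (hν : ∀ t, charFun ν t = (φ (‖t‖ ^ 2) : ℂ)) (a : Fin n → ℝ) :
    P {ω | ∀ i, a i < X ω i} = orthantProb ν S fun i => Set.Iio (m i - a i) := by
  have hc := continuous_innerMap (gramVectors S)
  have hmeas : MeasurableSet {x : EuclideanSpace ℝ (Fin n) | ∀ i, a i < x i} := by
    rw [Set.ofPred_forall]
    exact MeasurableSet.iInter fun i => measurableSet_lt measurable_const (by fun_prop)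
  have h := congrArg (fun μ => μ {x : EuclideanSpace ℝ (Fin n) | ∀ i, a i < x i}) (hX.map_eq hν)
  simp only [Measure.map_apply_of_aemeasurable hX.aemeasurable hmeas,
    Measure.map_apply (by fun_prop : Measurable fun z => m + innerMap (gramVectors S) z) hmeas] at h
  refine h.trans ?_
  -- Central symmetry of `ν` turns the upper orthant into a lower one.
  rw [orthantProb, ← (isRotationInvariant_of_charFun_eq hν).measure_preimage
    (LinearIsometryEquiv.neg ℝ)]
  congr 1
  ext z
  refine forall_congr' fun i => ?_
  simp only [innerMap, PiLp.add_apply, LinearIsometryEquiv.coe_neg, inner_neg_right, Set.mem_Iio]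
  constructor <;> intro h <;> linarith

/-- If `ν` had bounded support, `X` would be concentrated on the compact affine image of that
support. -/
theorem IsElliptical.not_isBounded_support (hX : IsElliptical X P m S φ)
    (hν : ∀ t, charFun ν t = (φ (‖t‖ ^ 2) : ℂ))
    (hb : ¬ Bornology.IsBounded (P.map X).support) : ¬ Bornology.IsBounded ν.support := by
  intro h
  apply hb
  set f := fun z => m + innerMap (gramVectors S) z
  have hf : Continuous f := continuous_const.add (continuous_innerMap _)
  have hK : IsCompact (f '' ν.support) :=
    (Metric.isCompact_of_isClosed_isBounded Measure.isClosed_support h).image hf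
  refine hK.isBounded.subset (Measure.support_subset_of_isClosed hK.isClosed ?_)
  rw [hX.map_eq hν, mem_ae_map_iff hf.measurable.aemeasurable hK.measurableSet]
  exact mem_of_superset Measure.support_mem_ae (Set.subset_preimage_image f _)

omit [IsProbabilityMeasure P] in
theorem IsElliptical.charFun_map_apply (hX : IsElliptical X P m S φ) (i : Fin n) (t : ℝ) :
    charFun (P.map fun ω => X ω i) t =
      Complex.exp (Complex.I * ((t * m i : ℝ) : ℂ)) * (φ (S i i * t ^ 2) : ℂ) := by
  have h1 : P.map (fun ω => X ω i) = (P.map X).map fun x => x i := by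
    rw [AEMeasurable.map_map_of_aemeasurable (by fun_prop) hX.aemeasurable]; rfl
  have h3 : (EuclideanSpace.single i t).ofLp = Pi.single i t := by
    ext j; simp [Pi.single_apply]
  have h2 : charFun ((P.map X).map fun x => x i) t =
      charFun (P.map X) (EuclideanSpace.single i t) := by
    simp only [charFun_apply]
    rw [integral_map (by fun_prop) (by fun_prop)]
    congr with x
    rw [inner_eq_dotProduct, h3, single_dotProduct, real_inner_comm]
    simp [mul_comm]
  rw [h1, h2, hX.charFun_eq]
  rw [h3]
  congr 3
  · simp
  · simp [mulVec_single]; ring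

omit [IsProbabilityMeasure P] in
/-- If `φ` is invariant under a nontrivial scaling, then it is constant. -/
theorem generator_eq_one_of_scaling (hν : ∀ t, charFun ν t = (φ (‖t‖ ^ 2) : ℂ)) (i : Fin n)
    {a b : ℝ} (ha : 0 ≤ a) (hab : a < b) (h : ∀ u, 0 ≤ u → φ (a * u) = φ (b * u)) {u : ℝ}
    (hu : 0 ≤ u) : φ u = 1 := by
  have hb : 0 < b := ha.trans_lt hab
  have hr : 0 ≤ a / b := by positivity
  have hr1 : a / b < 1 := (div_lt_one hb).2 hab
  -- Iterating the scaling moves the argument to `0`, where `φ` is continuous with value `1`.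
  have hk : ∀ k : ℕ, φ ((a / b) ^ k * u) = φ u := fun k => by
    induction k with
    | zero => simp
    | succ k ih =>
      rw [← ih]
      have := h ((a / b) ^ k * u / b) (by positivity)
      rw [mul_div_cancel₀ _ hb.ne'] at this
      rw [← this]
      congr 1
      ring
  have hlim : Tendsto (fun k : ℕ => (a / b) ^ k * u) atTop (𝓝 0) := by
    simpa using (tendsto_pow_atTop_nhds_zero_of_lt_one hr hr1).mul_const u
  have h0 := ((continuousOn_generator hν i) 0 Set.self_mem_Ici).tendsto.comp
    (tendsto_nhdsWithin_iff.2 ⟨hlim, Eventually.of_forall fun k =>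
      Set.mem_Ici.2 (by positivity : 0 ≤ (a / b) ^ k * u)⟩)
  rw [generator_zero hν] at h0
  refine tendsto_nhds_unique (tendsto_const_nhds.congr fun k => ?_) h0
  exact (hk k).symm

/-- The phase and the real factor of a one-dimensional elliptical characteristic function are
determined by the function. -/
theorem eq_and_eq_of_charFun_eq (hν : ∀ t, charFun ν t = (φ (‖t‖ ^ 2) : ℂ)) (i : Fin n)
    {a b p q : ℝ} (ha : 0 ≤ a) (hb : 0 ≤ b)
    (h : ∀ t : ℝ, Complex.exp (Complex.I * ((t * p : ℝ) : ℂ)) * (φ (a * t ^ 2) : ℂ) =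
      Complex.exp (Complex.I * ((t * q : ℝ) : ℂ)) * (φ (b * t ^ 2) : ℂ)) :
    p = q ∧ (a = b ∨ ∀ u, 0 ≤ u → φ u = 1) := by
  have hrot : ∀ t : ℝ, Complex.exp (((t * (p - q) : ℝ) : ℂ) * Complex.I) * (φ (a * t ^ 2) : ℂ) =
      (φ (b * t ^ 2) : ℂ) := fun t => by
    have e : Complex.exp (((t * (p - q) : ℝ) : ℂ) * Complex.I) =
        Complex.exp (-(Complex.I * ((t * q : ℝ) : ℂ))) *
          Complex.exp (Complex.I * ((t * p : ℝ) : ℂ)) := by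
      rw [← Complex.exp_add]; congr 1; push_cast; ring
    rw [e, mul_assoc, h, ← mul_assoc, ← Complex.exp_add]
    simp
  -- Since `φ` is real, the imaginary part vanishes. Near `t = 0` the factor `φ` is positive, so the
  -- sine must vanish at a small nonzero argument unless `p = q`.
  have hsin : ∀ t : ℝ, Real.sin (t * (p - q)) * φ (a * t ^ 2) = 0 := fun t => by
    have := congrArg Complex.im (hrot t)
    rwa [Complex.im_mul_ofReal, Complex.exp_ofReal_mul_I_im, Complex.ofReal_im] at this
  have hpq : p = q := by
    by_contra hne
    have hd : p - q ≠ 0 := sub_ne_zero.2 hne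
    have hat : Tendsto (fun t : ℝ => a * t ^ 2) (𝓝 0) (𝓝 0) := by
      have : Continuous fun t : ℝ => a * t ^ 2 := by fun_prop
      simpa using this.tendsto 0
    have hφ : Tendsto (fun t : ℝ => φ (a * t ^ 2)) (𝓝 0) (𝓝 1) := by
      rw [← generator_zero hν]
      exact ((continuousOn_generator hν i) 0 Set.self_mem_Ici).tendsto.comp
        (tendsto_nhdsWithin_iff.2 ⟨hat, Eventually.of_forall fun t =>
          Set.mem_Ici.2 (by positivity : 0 ≤ a * t ^ 2)⟩)
    have hdt : Tendsto (fun t : ℝ => |t * (p - q)|) (𝓝 0) (𝓝 0) := by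
      have : Continuous fun t : ℝ => |t * (p - q)| := by fun_prop
      simpa using this.tendsto 0
    have hev : ∀ᶠ t : ℝ in 𝓝[>] 0, 0 < φ (a * t ^ 2) ∧ |t * (p - q)| < Real.pi :=
      ((hφ.eventually_const_lt one_pos).and (hdt.eventually_lt_const Real.pi_pos)).filter_mono
        nhdsWithin_le_nhds
    obtain ⟨t, ⟨h1, h2⟩, h3⟩ := (hev.and eventually_mem_nhdsWithin).exists
    have hs : Real.sin (t * (p - q)) = 0 := (mul_eq_zero.1 (hsin t)).resolve_right h1.ne'
    rw [abs_lt] at h2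
    exact mul_ne_zero (ne_of_gt h3) hd ((Real.sin_eq_zero_iff_of_lt_of_lt h2.1 h2.2).1 hs)
  refine ⟨hpq, ?_⟩
  subst hpq
  have hφ : ∀ u, 0 ≤ u → φ (a * u) = φ (b * u) := fun u hu => by
    have := hrot √u
    rw [Real.sq_sqrt hu] at this
    simpa using this
  rcases lt_trichotomy a b with hab | hab | hab
  · exact Or.inr fun u hu => generator_eq_one_of_scaling hν i ha hab hφ hu
  · exact Or.inl hab
  · exact Or.inr fun u hu =>
      generator_eq_one_of_scaling hν i hb hab (fun u hu => (hφ u hu).symm) hu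

theorem IsElliptical.map_eq_dirac (hX : IsElliptical X P m S φ)
    (hφ : ∀ u, 0 ≤ u → φ u = 1) : P.map X = Measure.dirac m := by
  have : IsProbabilityMeasure (P.map X) := Measure.isProbabilityMeasure_map hX.aemeasurable
  refine Measure.ext_of_charFun (funext fun t => ?_)
  have h0 : 0 ≤ t.ofLp ⬝ᵥ (S *ᵥ t.ofLp) := by
    simpa using hX.posSemidef.dotProduct_mulVec_nonneg t.ofLp
  rw [hX.charFun_eq, hφ _ h0, charFun_dirac, inner_eq_dotProduct, mul_comm Complex.I]
  simp

theorem orthantProb_eq_of_generator_eq_one (hν : ∀ t, charFun ν t = (φ (‖t‖ ^ 2) : ℂ))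
    (hφ : ∀ u, 0 ≤ u → φ u = 1) {T : Matrix (Fin n) (Fin n) ℝ} (hS : S.PosSemidef)
    (hT : T.PosSemidef) {L : Fin n → Set ℝ} (hL : ∀ i, MeasurableSet (L i)) :
    orthantProb ν S L = orthantProb ν T L := by
  rw [orthantProb_eq_ellipticalLaw hL, orthantProb_eq_ellipticalLaw hL]
  have (M : Matrix (Fin n) (Fin n) ℝ) :
      IsProbabilityMeasure (ellipticalLaw ν M : Measure (EuclideanSpace ℝ (Fin n))) :=
    (ellipticalLaw ν M).2
  suffices h : (ellipticalLaw ν S : Measure (EuclideanSpace ℝ (Fin n))) = ellipticalLaw ν T by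
    rw [h]
  refine Measure.ext_of_charFun (funext fun t => ?_)
  have hS0 := hS.dotProduct_mulVec_nonneg t.ofLp
  have hT0 := hT.dotProduct_mulVec_nonneg t.ofLp
  rw [star_trivial] at hS0 hT0
  exact (charFun_ellipticalLaw hν hS t).trans
    (by rw [hφ _ hS0, ← hφ _ hT0]; exact (charFun_ellipticalLaw hν hT t).symm)

end Elliptical

/-! ### The comparison theorem -/

theorem theorem4p1 {Ω Ω' : Type*} [MeasurableSpace Ω] [MeasurableSpace Ω']
    (P : Measure Ω) [IsProbabilityMeasure P] (Q : Measure Ω') [IsProbabilityMeasure Q]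
    (n : ℕ) (X : Ω → EuclideanSpace ℝ (Fin n)) (Y : Ω' → EuclideanSpace ℝ (Fin n))
    (mx my : EuclideanSpace ℝ (Fin n)) (Sx Sy : Matrix (Fin n) (Fin n) ℝ) (φ : ℝ → ℝ)
    (hX : IsElliptical X P mx Sx φ) (hY : IsElliptical Y Q my Sy φ)
    (hmarg : ∀ i : Fin n, P.map (fun ω => X ω i) = Q.map (fun ω => Y ω i))
    (hS : ∀ i j : Fin n, i < j → Sx i j ≤ Sy i j) :
    (∀ a : Fin n → ℝ,
      P {ω | ∀ i, X ω i ≤ a i} ≤ Q {ω | ∀ i, Y ω i ≤ a i} ∧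
      P {ω | ∀ i, a i < X ω i} ≤ Q {ω | ∀ i, a i < Y ω i}) ∧
    ((∃ i j : Fin n, Sx i j < Sy i j) →
      ¬ Bornology.IsBounded (P.map X).support →
      ¬ Bornology.IsBounded (Q.map Y).support →
      (Sx + Sy).PosDef →
      ∀ a : Fin n → ℝ,
        P {ω | ∀ i, X ω i ≤ a i} < Q {ω | ∀ i, Y ω i ≤ a i} ∧
        P {ω | ∀ i, a i < X ω i} < Q {ω | ∀ i, a i < Y ω i}) := by
  obtain ⟨ν, hνp, hν⟩ := hX.generator
  have hcf : ∀ i, mx i = my i ∧ (Sx i i = Sy i i ∨ ∀ u, 0 ≤ u → φ u = 1) := fun i =>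
    eq_and_eq_of_charFun_eq hν i hX.posSemidef.diag_nonneg hY.posSemidef.diag_nonneg fun t => by
      rw [← hX.charFun_map_apply i t, ← hY.charFun_map_apply i t, hmarg]
  obtain rfl : mx = my := by
    ext i; exact (hcf i).1
  simp only [hX.measure_le_eq hν, hX.measure_lt_eq hν, hY.measure_le_eq hν, hY.measure_lt_eq hν]
  -- In the degenerate case the marginals do not determine the diagonals, but the law does not
  -- depend on the dispersion matrix, and a point mass has bounded support.
  by_cases hφ : ∀ u, 0 ≤ u → φ u = 1
  · have heq : ∀ L : Fin n → Set ℝ, (∀ i, MeasurableSet (L i)) →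
        orthantProb ν Sx L = orthantProb ν Sy L := fun L hL =>
      orthantProb_eq_of_generator_eq_one hν hφ hX.posSemidef hY.posSemidef hL
    refine ⟨fun a => ⟨(heq _ fun i => measurableSet_Iic).le, (heq _ fun i => measurableSet_Iio).le⟩,
      fun _ hbX => absurd ?_ hbX⟩
    rw [hX.map_eq_dirac hφ]
    exact (Bornology.isBounded_singleton (x := mx)).subset
      (Measure.support_subset_of_isClosed isClosed_singleton (by simp))
  · have hdiag : ∀ i, Sx i i = Sy i i := fun i => (hcf i).2.resolve_right hφ
    obtain ⟨D, rfl⟩ : ∃ D, Sy = Sx + D := ⟨Sy - Sx, by abel⟩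
    have hD : D.IsHermitian := by simpa using hY.posSemidef.1.sub hX.posSemidef.1
    have hD0 : ∀ i, D i i = 0 := fun i => by simpa using hdiag i
    have hnn : ∀ i j, 0 ≤ D i j := fun i j => by
      rcases lt_trichotomy i j with h | rfl | h
      · simpa using hS i j h
      · exact (hD0 i).ge
      · rw [← hD.apply i j]
        simpa using hS j i h
    refine ⟨fun a => ⟨orthantProb_Iic_le hν hX.posSemidef hY.posSemidef hD0 hnn _,
      orthantProb_Iio_le hν hX.posSemidef hY.posSemidef hD0 hnn _⟩, ?_⟩
    rintro ⟨i, j, hij⟩ hbX - hsum a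
    have hb := hX.not_isBounded_support hν hbX
    have hij' : 0 < D i j := by simpa using hij
    exact ⟨orthantProb_lt_of_add_posDef hν hb hX.posSemidef hY.posSemidef hsum hD0 hnn hij'
        (fun i => isLowerSet_Iic _) (fun i => Set.nonempty_Iic) (fun i => (Set.ne_univ_iff_exists_notMem _).2 ⟨_, Set.notMem_Iic.2 (lt_add_one _)⟩)
        fun h1 h2 h3 h4 => orthantProb_Iic_le hν h1 h2 h3 h4 _,
      orthantProb_lt_of_add_posDef hν hb hX.posSemidef hY.posSemidef hsum hD0 hnn hij'
        (fun i => isLowerSet_Iio _) (fun i => Set.nonempty_Iio) (fun i => (Set.ne_univ_iff_exists_notMem _).2 ⟨_, Set.notMem_Iio.2 le_rfl⟩)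
        fun h1 h2 h3 h4 => orthantProb_Iio_le hν h1 h2 h3 h4 _⟩
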